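/- For a locally integrable $f:\mathbb{R}^n\to\mathbb{R}$ let $$Mf(x)=\sup_{R>0}\frac{1}{m(B_R(x))}\int_{B_R(x)}|f(y)|\,dy\in[0,\infty]$$ be the (centred) Hardy–Littlewood maximal function, where $B_R(x)$ is the ball of radius $R$ centred at $x$ and $m$ is Lebesgue measure. Let $1<p<\infty$ and let $W^{1,p}(\mathbb{R}^n)$ be the Sobolev space of real functions $f\in L^p(\mathbb{R}^n)$ with weak gradient $\nabla f\in L^p(\mathbb{R}^n)$, with the norm $\|f\|_{1,p}=\|f\|_p+\|\nabla f\|_p$. Suppose that $u_k\rightharpoonup u$ weakly in $W^{1,p}(\mathbb{R}^n)$ as $k\to\infty$. Then there is a subsequence $(u_{k_j})_{j\ge 1}$ such that, for almost every $x\in\mathbb{R}^n$, $Mu(x)<\infty$ and $M(u_{k_j})(x)\to M(u)(x)$ as $j\to\infty$. -/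

import Mathlib

open MeasureTheory Filter Topology
open scoped ENNReal ContDiff

/-- Euclidean space `ℝⁿ`, with the Euclidean norm and Lebesgue measure `volume`. -/
abbrev Rn (n : ℕ) : Type := EuclideanSpace ℝ (Fin n)

/-- The (centred) Hardy–Littlewood maximal function
`Mf(x) = sup_{R > 0} (1 / m(B_R)) ∫_{B_R(x)} |f(y)| dy`, as a `[0, ∞]`-valued function. -/
noncomputable def hlMaximal {n : ℕ} (f : Rn n → ℝ) (x : Rn n) : ℝ≥0∞ :=
  ⨆ (R : ℝ) (_ : 0 < R),
    (∫⁻ y in Metric.ball x R, ‖f y‖ₑ) / volume (Metric.ball x R)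

/-- `g` is the weak gradient of `f` on `ℝⁿ`: for every test function `φ ∈ C_c^∞(ℝⁿ)` and every
coordinate `i`, `∫ f ∂ᵢφ = - ∫ gᵢ φ`. It is used for locally integrable `f` and `g` only. -/
def IsWeakGradient {n : ℕ} (f : Rn n → ℝ) (g : Rn n → Rn n) : Prop :=
  ∀ φ : Rn n → ℝ, ContDiff ℝ ∞ φ → HasCompactSupport φ → ∀ i : Fin n,
    ∫ x, f x * fderiv ℝ φ x (EuclideanSpace.single i 1) = - ∫ x, g x i * φ x

theorem locallyIntegrable_coord {n : ℕ} {g : Rn n → Rn n} (hg : LocallyIntegrable g volume)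
    (i : Fin n) : LocallyIntegrable (fun x => g x i) volume := by
  intro x
  obtain ⟨s, hs, h⟩ := hg x
  exact ⟨s, hs, (EuclideanSpace.proj (𝕜 := ℝ) i : Rn n →L[ℝ] ℝ).integrable_comp h⟩

theorem integrable_mul_test {n : ℕ} {f : Rn n → ℝ} (hf : LocallyIntegrable f volume)
    {φ : Rn n → ℝ} (hφ : Continuous φ) (hc : HasCompactSupport φ) :
    Integrable (fun x => f x * φ x) volume := by
  simpa [smul_eq_mul, mul_comm] using hf.integrable_smul_left_of_hasCompactSupport hφ hc

theorem integrable_mul_partial {n : ℕ} {f : Rn n → ℝ} (hf : LocallyIntegrable f volume)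
    {φ : Rn n → ℝ} (hφ : ContDiff ℝ ∞ φ) (hc : HasCompactSupport φ) (v : Rn n) :
    Integrable (fun x => f x * fderiv ℝ φ x v) volume :=
  integrable_mul_test hf ((hφ.continuous_fderiv (by simp)).clm_apply continuous_const)
    (hc.fderiv_apply (𝕜 := ℝ) v)

theorem IsWeakGradient.congr_ae {n : ℕ} {f f' : Rn n → ℝ} {g g' : Rn n → Rn n}
    (h : IsWeakGradient f g) (hf : f' =ᵐ[volume] f) (hg : g' =ᵐ[volume] g) :
    IsWeakGradient f' g' := by
  intro φ hφ hc i
  have h1 : ∫ x, f' x * fderiv ℝ φ x (EuclideanSpace.single i 1)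
      = ∫ x, f x * fderiv ℝ φ x (EuclideanSpace.single i 1) :=
    integral_congr_ae (by filter_upwards [hf] with x hx; rw [hx])
  have h2 : ∫ x, g' x i * φ x = ∫ x, g x i * φ x :=
    integral_congr_ae (by filter_upwards [hg] with x hx; rw [hx])
  rw [h1, h2, h φ hφ hc i]

theorem IsWeakGradient.add {n : ℕ} {f f' : Rn n → ℝ} {g g' : Rn n → Rn n}
    (hf : LocallyIntegrable f volume) (hf' : LocallyIntegrable f' volume)
    (hg : LocallyIntegrable g volume) (hg' : LocallyIntegrable g' volume)
    (h : IsWeakGradient f g) (h' : IsWeakGradient f' g') :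
    IsWeakGradient (f + f') (g + g') := by
  intro φ hφ hc i
  simp only [Pi.add_apply, PiLp.add_apply, add_mul]
  rw [integral_add (integrable_mul_partial hf hφ hc _) (integrable_mul_partial hf' hφ hc _),
    integral_add (integrable_mul_test (locallyIntegrable_coord hg i) hφ.continuous hc)
      (integrable_mul_test (locallyIntegrable_coord hg' i) hφ.continuous hc),
    h φ hφ hc i, h' φ hφ hc i, neg_add]

theorem IsWeakGradient.const_smul {n : ℕ} {f : Rn n → ℝ} {g : Rn n → Rn n}
    (h : IsWeakGradient f g) (c : ℝ) : IsWeakGradient (c • f) (c • g) := by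
  intro φ hφ hc i
  simp only [Pi.smul_apply, PiLp.smul_apply, smul_eq_mul, mul_assoc, integral_const_mul]
  rw [h φ hφ hc i, mul_neg]

/-- The Sobolev space `W^{1,p}(ℝⁿ)` of real functions `f ∈ L^p` with weak gradient `∇f ∈ L^p`,
realized as the space of pairs `(f, ∇f)` with the norm `‖f‖_p + ‖∇f‖_p` (`WithLp 1` puts the sum
norm on the product). The weak gradient is unique, so that the pair is determined by `f`: see
`sobolevW1p_ext`. -/
noncomputable def SobolevW1p (n : ℕ) (p : ℝ≥0∞) [hp : Fact (1 ≤ p)] :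
    Submodule ℝ (WithLp 1 (Lp ℝ p (volume : Measure (Rn n)) × Lp (Rn n) p (volume : Measure (Rn n))))
    where
  carrier := {w | IsWeakGradient (w.fst : Rn n → ℝ) (w.snd : Rn n → Rn n)}
  zero_mem' := by
    have h0 : IsWeakGradient (0 : Rn n → ℝ) (0 : Rn n → Rn n) := by
      intro φ _ _ i
      simp
    exact h0.congr_ae (Lp.coeFn_zero _ _ _) (Lp.coeFn_zero _ _ _)
  add_mem' {a b} ha hb :=
    (IsWeakGradient.add ((Lp.memLp a.fst).locallyIntegrable hp.out)
      ((Lp.memLp b.fst).locallyIntegrable hp.out) ((Lp.memLp a.snd).locallyIntegrable hp.out)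
      ((Lp.memLp b.snd).locallyIntegrable hp.out) ha hb).congr_ae
      (Lp.coeFn_add _ _) (Lp.coeFn_add _ _)
  smul_mem' c a ha :=
    (IsWeakGradient.const_smul ha c).congr_ae (Lp.coeFn_smul _ _) (Lp.coeFn_smul _ _)

/-- The `L^p` function underlying an element of `W^{1,p}(ℝⁿ)`. -/
noncomputable def sobolevFun {n : ℕ} {p : ℝ≥0∞} [Fact (1 ≤ p)] (u : SobolevW1p n p) :
    Rn n → ℝ :=
  (u.1.fst : Lp ℝ p (volume : Measure (Rn n)))

/-- The weak gradient is unique: an element of `W^{1,p}(ℝⁿ)` is determined by its function. -/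
theorem sobolevW1p_ext {n : ℕ} {p : ℝ≥0∞} [hp : Fact (1 ≤ p)] {u v : SobolevW1p n p}
    (h : sobolevFun u =ᵐ[volume] sobolevFun v) : u = v := by
  have hfst : u.1.fst = v.1.fst := Lp.ext h
  have hu := (Lp.memLp u.1.snd).locallyIntegrable hp.out
  have hv := (Lp.memLp v.1.snd).locallyIntegrable hp.out
  have key : ∀ i : Fin n, ∀ᵐ x ∂(volume : Measure (Rn n)),
      (u.1.snd : Rn n → Rn n) x i = (v.1.snd : Rn n → Rn n) x i := by
    intro i
    refine ae_eq_of_integral_contDiff_smul_eq (locallyIntegrable_coord hu i)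
      (locallyIntegrable_coord hv i) ?_
    intro φ hφ hc
    have h1 := u.2 φ hφ hc i
    have h2 := v.2 φ hφ hc i
    rw [hfst, h2] at h1
    simpa [smul_eq_mul, mul_comm] using (neg_injective h1).symm
  have hsnd : u.1.snd = v.1.snd := by
    refine Lp.ext ?_
    filter_upwards [ae_all_iff.2 key] with x hx
    ext i
    exact hx i
  exact Subtype.ext ((WithLp.ofLp_injective 1) (Prod.ext hfst hsnd))

/-!
Put `v k = u k - u₀`, which is bounded in `W^{1,p}` and tends weakly to zero. Since `M` is sublinear
and `M u₀` is finite almost everywhere, it is enough that `M (v k) → 0` almost everywhere along a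
subsequence.

Averages of `|v k|` over balls of radius `R ≥ j` are at most `m(B_j)^{-1/p} ‖v k‖_p`, hence
uniformly small, and averages over smaller balls centred in `B_j(0)` only see `v k` on `B_{2j}(0)`
(`exists_hlMaximal_le_max`). If `v k → 0` in `L¹(B_{2j}(0))` for every `j`, a subsequence may be
chosen along which these `L¹` norms decrease geometrically, and the weak type `(1,1)` inequality
(`mul_volume_lt_hlMaximal_le`, by Vitali covering) with the Borel–Cantelli lemma gives the claim
(`exists_subseq_hlMaximal_tendsto_zero`).

Convergence in `L¹` of balls is the compactness theorem of Rellich and Kondrachov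
(`tendsto_setLIntegral_sobolevFun_of_weak`). It is derived from the translation estimate
`‖f(· + h) - f‖_{L¹(B_r)} ≤ |h| ‖∇f‖_{L¹(B_{r+2})}`, by which `v k` is close to its mollification
at a small scale, uniformly in `k` (`setLIntegral_enorm_mollify_sub_le`). At a fixed scale the value
of the mollification at a point is a continuous linear functional of `v k`, so it tends to zero, and
dominated convergence applies.
-/

/-! ### The maximal function -/

theorem hlMaximal_le_iff {n : ℕ} {f : Rn n → ℝ} {x : Rn n} {c : ℝ≥0∞} :
    hlMaximal f x ≤ c ↔ ∀ R : ℝ, 0 < R →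
      (∫⁻ y in Metric.ball x R, ‖f y‖ₑ) / volume (Metric.ball x R) ≤ c := by
  simp only [hlMaximal, iSup_le_iff]

theorem le_hlMaximal {n : ℕ} (f : Rn n → ℝ) (x : Rn n) {R : ℝ} (hR : 0 < R) :
    (∫⁻ y in Metric.ball x R, ‖f y‖ₑ) / volume (Metric.ball x R) ≤ hlMaximal f x :=
  hlMaximal_le_iff.1 le_rfl R hR

theorem hlMaximal_congr_ae {n : ℕ} {f g : Rn n → ℝ} (h : f =ᵐ[volume] g) (x : Rn n) :
    hlMaximal f x = hlMaximal g x := by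
  unfold hlMaximal
  refine iSup_congr fun R => iSup_congr fun _ => ?_
  congr 1
  refine lintegral_congr_ae (ae_restrict_of_ae ?_)
  filter_upwards [h] with y hy
  rw [hy]

theorem hlMaximal_neg {n : ℕ} (f : Rn n → ℝ) (x : Rn n) :
    hlMaximal (-f) x = hlMaximal f x := by
  simp [hlMaximal]

theorem hlMaximal_add_le {n : ℕ} {f : Rn n → ℝ} (hf : AEMeasurable f) (g : Rn n → ℝ)
    (x : Rn n) : hlMaximal (f + g) x ≤ hlMaximal f x + hlMaximal g x := by
  refine hlMaximal_le_iff.2 fun R hR => ?_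
  calc (∫⁻ y in Metric.ball x R, ‖(f + g) y‖ₑ) / volume (Metric.ball x R)
      ≤ (∫⁻ y in Metric.ball x R, (‖f y‖ₑ + ‖g y‖ₑ)) / volume (Metric.ball x R) := by
        gcongr with y
        exact enorm_add_le _ _
    _ = (∫⁻ y in Metric.ball x R, ‖f y‖ₑ) / volume (Metric.ball x R)
        + (∫⁻ y in Metric.ball x R, ‖g y‖ₑ) / volume (Metric.ball x R) := by
        rw [lintegral_add_left' hf.enorm.restrict, ENNReal.add_div]
    _ ≤ _ := add_le_add (le_hlMaximal f x hR) (le_hlMaximal g x hR)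

theorem volume_closedBall_five_mul {n : ℕ} (x : Rn n) {r : ℝ} (hr : 0 < r) :
    volume (Metric.closedBall x (5 * r)) = ENNReal.ofReal (5 ^ n) * volume (Metric.ball x r) := by
  rw [Measure.addHaar_closedBall_mul _ _ (by norm_num) hr.le]
  congr 1
  · simp
  · rcases subsingleton_or_nontrivial (Rn n) with h | h
    · congr 1
      ext y
      simp [Subsingleton.elim y 0, Subsingleton.elim x 0, hr, hr.le]
    · rw [Measure.addHaar_closedBall_eq_addHaar_ball, Measure.addHaar_ball_center _ x]

/-- The Hardy–Littlewood weak type `(1,1)` inequality. The left-hand side is an outer measure, so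
that measurability of the maximal function plays no role. -/
theorem mul_volume_lt_hlMaximal_le {n : ℕ} (f : Rn n → ℝ) (t : ℝ≥0∞) :
    t * volume {x | t < hlMaximal f x} ≤ ENNReal.ofReal (5 ^ n) * ∫⁻ y, ‖f y‖ₑ := by
  -- The covering lemma needs bounded radii, so radii are first restricted to `R ≤ N`.
  set E : ℕ → Set (Rn n) := fun N => {x | ∃ R : ℝ, 0 < R ∧ R ≤ N ∧
    t < (∫⁻ y in Metric.ball x R, ‖f y‖ₑ) / volume (Metric.ball x R)} with hE
  have hEmono : Monotone E := by
    rintro N N' hN x ⟨R, h0, h1, h2⟩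
    exact ⟨R, h0, h1.trans (by exact_mod_cast hN), h2⟩
  have hEU : {x | t < hlMaximal f x} = ⋃ N, E N := by
    ext x
    simp only [hlMaximal, Set.mem_ofPred_eq, lt_iSup_iff, Set.mem_iUnion, hE]
    constructor
    · rintro ⟨R, h0, h⟩
      obtain ⟨N, hN⟩ := exists_nat_ge R
      exact ⟨N, R, h0, hN, h⟩
    · rintro ⟨N, R, h0, -, h⟩
      exact ⟨R, h0, h⟩
  rw [hEU, hEmono.measure_iUnion, ENNReal.mul_iSup]
  refine iSup_le fun N => ?_
  choose! r hr0 hrN hrt using fun x (hx : x ∈ E N) => hx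
  obtain ⟨s, hsE, hdisj, hcov⟩ :=
    Vitali.exists_disjoint_subfamily_covering_enlargement_closedBall (E N) id r N hrN 5 (by norm_num)
  simp only [id] at hdisj hcov
  have hdisj' : s.PairwiseDisjoint fun a => Metric.ball a (r a) :=
    hdisj.mono fun a => Metric.ball_subset_closedBall
  have hsc : s.Countable := hdisj'.countable_of_isOpen (fun _ _ => Metric.isOpen_ball)
    fun a ha => ⟨a, Metric.mem_ball_self (hr0 a (hsE ha))⟩
  have hsub : E N ⊆ ⋃ b ∈ s, Metric.closedBall b (5 * r b) := by
    intro x hx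
    obtain ⟨b, hb, hxb⟩ := hcov x hx
    exact Set.mem_biUnion hb (hxb (Metric.mem_closedBall_self (hr0 x hx).le))
  have hball : ∀ b : s, t * volume (Metric.closedBall (b : Rn n) (5 * r b))
      ≤ ENNReal.ofReal (5 ^ n) * ∫⁻ y in Metric.ball (b : Rn n) (r b), ‖f y‖ₑ := by
    rintro ⟨b, hb⟩
    have h0 := hr0 b (hsE hb)
    rw [volume_closedBall_five_mul b h0, mul_left_comm]
    gcongr
    exact (ENNReal.le_div_iff_mul_le (Or.inl (Metric.measure_ball_pos _ _ h0).ne')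
      (Or.inl measure_ball_lt_top.ne)).1 (hrt b (hsE hb)).le
  calc t * volume (E N)
      ≤ t * ∑' b : s, volume (Metric.closedBall (b : Rn n) (5 * r b)) := by
        gcongr
        exact (measure_mono hsub).trans (measure_biUnion_le _ hsc _)
    _ = ∑' b : s, t * volume (Metric.closedBall (b : Rn n) (5 * r b)) :=
        ENNReal.tsum_mul_left.symm
    _ ≤ ∑' b : s, ENNReal.ofReal (5 ^ n) * ∫⁻ y in Metric.ball (b : Rn n) (r b), ‖f y‖ₑ :=
        ENNReal.tsum_le_tsum hball
    _ = ENNReal.ofReal (5 ^ n) * ∫⁻ y in ⋃ b ∈ s, Metric.ball b (r b), ‖f y‖ₑ := by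
        rw [ENNReal.tsum_mul_left, lintegral_biUnion hsc (fun _ _ => measurableSet_ball) hdisj']
    _ ≤ _ := by
        gcongr
        exact Measure.restrict_le_self

theorem ae_hlMaximal_lt_top {n : ℕ} {f : Rn n → ℝ} (hf : ∫⁻ y, ‖f y‖ₑ ≠ ⊤) :
    ∀ᵐ x ∂(volume : Measure (Rn n)), hlMaximal f x < ⊤ := by
  have hC : ENNReal.ofReal (5 ^ n) * ∫⁻ y, ‖f y‖ₑ ≠ ⊤ := ENNReal.mul_ne_top ENNReal.ofReal_ne_top hf
  have hle : ∀ m : ℕ, (m : ℝ≥0∞) * volume {x | ¬ hlMaximal f x < ⊤} ≤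
      ENNReal.ofReal (5 ^ n) * ∫⁻ y, ‖f y‖ₑ := fun m => by
    refine le_trans ?_ (mul_volume_lt_hlMaximal_le f m)
    gcongr with x
    intro hx
    rw [not_lt_top_iff] at hx
    simp [hx]
  -- The measure `a` of the exceptional set satisfies `m * a ≤ const` for every `m`.
  by_contra hne
  obtain ⟨m, hm⟩ := ENNReal.exists_nat_mul_gt (show volume {x | ¬ hlMaximal f x < ⊤} ≠ 0 from hne) hC
  exact (hle m).not_gt hm

/-- Hölder's inequality against the indicator function of a set of finite measure. -/
theorem setLIntegral_enorm_le_eLpNorm {n : ℕ} {E : Type*} [NormedAddCommGroup E] {p : ℝ≥0∞}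
    (hp : 1 ≤ p) {f : Rn n → E} (hf : AEStronglyMeasurable f volume) (s : Set (Rn n)) :
    ∫⁻ y in s, ‖f y‖ₑ ≤ eLpNorm f p volume * volume s ^ (1 - 1 / p.toReal) := by
  rw [← eLpNorm_one_eq_lintegral_enorm]
  refine (eLpNorm_le_eLpNorm_mul_rpow_measure_univ hp hf.restrict).trans ?_
  simp only [Measure.restrict_apply_univ, ENNReal.toReal_one, ne_eq, one_ne_zero, not_false_eq_true,
    div_self]
  gcongr
  exact Measure.restrict_le_self

/-- On `B_j(0)` the maximal function splits into a local part, which only sees `f` on `B_{2j}(0)`,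
and the averages over radii at least `j`, which are small by Hölder's inequality, uniformly on
bounded sets of `L^p`. In dimension `0` all balls coincide and the second part is absent. -/
theorem exists_hlMaximal_le_max (n : ℕ) {p : ℝ≥0∞} (hp : 1 ≤ p) (hp' : p < ⊤) :
    ∃ τ : ℕ → ℝ≥0∞, Tendsto τ atTop (𝓝 0) ∧ ∀ f : Rn n → ℝ, AEStronglyMeasurable f volume →
      ∀ j : ℕ, 0 < j → ∀ x ∈ Metric.ball (0 : Rn n) j, hlMaximal f x ≤
        max (hlMaximal ((Metric.ball 0 (2 * j)).indicator f) x) (eLpNorm f p volume * τ j) := by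
  have hloc : ∀ (f : Rn n → ℝ) (j : ℕ), ∀ x ∈ Metric.ball (0 : Rn n) j, ∀ R : ℝ, 0 < R → R ≤ j →
      (∫⁻ y in Metric.ball x R, ‖f y‖ₑ) / volume (Metric.ball x R) ≤
        hlMaximal ((Metric.ball 0 (2 * j)).indicator f) x := by
    intro f j x hx R hR hRj
    refine le_trans (le_of_eq ?_) (le_hlMaximal _ x hR)
    congr 1
    refine setLIntegral_congr_fun measurableSet_ball fun y hy => ?_
    have : y ∈ Metric.ball (0 : Rn n) (2 * j) := by
      refine Metric.ball_subset_ball' ?_ hy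
      have := Metric.mem_ball.1 hx
      linarith
    simp [Set.indicator_of_mem this]
  rcases subsingleton_or_nontrivial (Rn n) with h | h
  · refine ⟨0, tendsto_const_nhds, fun f _ j hj x hx => le_max_of_le_left ?_⟩
    refine hlMaximal_le_iff.2 fun R hR => ?_
    have hj' : (0 : ℝ) < j := by exact_mod_cast hj
    have huniv : ∀ R : ℝ, 0 < R → Metric.ball x R = Set.univ := fun R hR =>
      Set.eq_univ_of_forall fun y => by simp [Subsingleton.elim y x, hR]
    rw [huniv R hR, ← huniv j hj']
    exact hloc f j x hx j hj' le_rfl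
  · have hpr : 0 < p.toReal := ENNReal.toReal_pos (by positivity) hp'.ne
    refine ⟨fun j => volume (Metric.ball (0 : Rn n) j) ^ (-(1 / p.toReal)), ?_, ?_⟩
    · have hv : Tendsto (fun j : ℕ => volume (Metric.ball (0 : Rn n) j)) atTop (𝓝 ⊤) := by
        have hmono : Monotone fun j : ℕ => Metric.ball (0 : Rn n) (j : ℝ) := fun a b hab =>
          Metric.ball_subset_ball (by exact_mod_cast hab)
        have := tendsto_measure_iUnion_atTop (μ := (volume : Measure (Rn n))) hmono
        rwa [Metric.iUnion_ball_nat, measure_univ_of_isAddLeftInvariant] at this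
      have := (ENNReal.continuous_rpow_const (y := -(1 / p.toReal))).tendsto ⊤ |>.comp hv
      rwa [ENNReal.top_rpow_of_neg (by simpa using hpr)] at this
    · intro f hf j hj x hx
      refine hlMaximal_le_iff.2 fun R hR => ?_
      rcases le_total R j with hRj | hRj
      · exact le_max_of_le_left (hloc f j x hx R hR hRj)
      · refine le_max_of_le_right ?_
        have hv0 : volume (Metric.ball x R) ≠ 0 := (Metric.measure_ball_pos _ _ hR).ne'
        have hvt : volume (Metric.ball x R) ≠ ⊤ := measure_ball_lt_top.ne
        calc (∫⁻ y in Metric.ball x R, ‖f y‖ₑ) / volume (Metric.ball x R)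
            ≤ eLpNorm f p volume * volume (Metric.ball x R) ^ (1 - 1 / p.toReal)
              / volume (Metric.ball x R) := by
              gcongr
              exact setLIntegral_enorm_le_eLpNorm hp hf _
          _ = eLpNorm f p volume * volume (Metric.ball x R) ^ (-(1 / p.toReal)) := by
              rw [mul_div_assoc, sub_eq_neg_add, ENNReal.rpow_add _ _ hv0 hvt, ENNReal.rpow_one,
                ENNReal.mul_div_cancel_right hv0 hvt]
          _ ≤ _ := by
              rw [Measure.addHaar_ball_center]
              gcongr
              simp only [ENNReal.rpow_neg]
              rw [ENNReal.inv_le_inv]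
              exact ENNReal.rpow_le_rpow (measure_mono (Metric.ball_subset_ball hRj)) (by positivity)

theorem ae_hlMaximal_lt_top_of_memLp {n : ℕ} {p : ℝ≥0∞} (hp : 1 ≤ p) (hp' : p < ⊤) {f : Rn n → ℝ}
    (hf : MemLp f p volume) : ∀ᵐ x ∂(volume : Measure (Rn n)), hlMaximal f x < ⊤ := by
  obtain ⟨τ, hτ, hle⟩ := exists_hlMaximal_le_max n hp hp'
  have hloc : ∀ᵐ x ∂(volume : Measure (Rn n)), ∀ j : ℕ,
      hlMaximal ((Metric.ball 0 (2 * j)).indicator f) x < ⊤ := by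
    refine ae_all_iff.2 fun j => ae_hlMaximal_lt_top ?_
    simp_rw [enorm_indicator_eq_indicator_enorm]
    rw [lintegral_indicator measurableSet_ball]
    have hint := (hf.locallyIntegrable hp).integrableOn_isCompact
      (isCompact_closedBall (0 : Rn n) (2 * j))
    exact (hint.mono_set Metric.ball_subset_closedBall).hasFiniteIntegral.ne
  filter_upwards [hloc] with x hx
  obtain ⟨J, hJ⟩ := exists_nat_gt (dist x 0)
  obtain ⟨j, hτj, hjJ⟩ :=
    ((hτ.eventually_lt_const ENNReal.zero_lt_top).and (eventually_ge_atTop (J + 1))).exists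
  have hxj : x ∈ Metric.ball (0 : Rn n) j := hJ.trans (by exact_mod_cast hjJ)
  exact (hle f hf.1 j (by omega) x hxj).trans_lt (max_lt (hx j) (ENNReal.mul_lt_top hf.2 hτj))

/-- A bounded sequence in `L^p` tending to zero in `L¹_loc` has a subsequence whose maximal
functions tend to zero almost everywhere. -/
theorem exists_subseq_hlMaximal_tendsto_zero {n : ℕ} {p : ℝ≥0∞} (hp : 1 ≤ p) (hp' : p < ⊤)
    {v : ℕ → Rn n → ℝ} (hv : ∀ k, AEStronglyMeasurable (v k) volume) {C : ℝ≥0∞} (hC : C ≠ ⊤)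
    (hvC : ∀ k, eLpNorm (v k) p volume ≤ C)
    (hloc : ∀ r : ℝ, Tendsto (fun k => ∫⁻ y in Metric.ball 0 r, ‖v k y‖ₑ) atTop (𝓝 0)) :
    ∃ k : ℕ → ℕ, StrictMono k ∧ ∀ᵐ x ∂(volume : Measure (Rn n)),
      Tendsto (fun j => hlMaximal (v (k j)) x) atTop (𝓝 0) := by
  obtain ⟨τ, hτ, hle⟩ := exists_hlMaximal_le_max n hp hp'
  -- Along the subsequence the `L¹` norm on `B_{2j}` is below `q ^ j * q ^ j`, so that the weak type
  -- inequality at height `q ^ j` leaves exceptional sets of summable measure.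
  set q : ℝ≥0∞ := 2⁻¹ with hq
  have hq0 : q ≠ 0 := by simp [hq]
  have hq1 : q < 1 := by simp [hq]
  obtain ⟨k, hk, hkj⟩ : ∃ k : ℕ → ℕ, StrictMono k ∧
      ∀ j : ℕ, ∫⁻ y in Metric.ball 0 (2 * j), ‖v (k j) y‖ₑ < q ^ j * q ^ j := by
    refine extraction_forall_of_eventually
      (P := fun j k => ∫⁻ y in Metric.ball 0 (2 * (j : ℝ)), ‖v k y‖ₑ < q ^ j * q ^ j) fun j => ?_
    exact (hloc (2 * j)).eventually_lt_const (by positivity)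
  refine ⟨k, hk, ?_⟩
  set w : ℕ → Rn n → ℝ := fun j => (Metric.ball 0 (2 * (j : ℝ))).indicator (v (k j)) with hw
  have hwint : ∀ j, ∫⁻ y, ‖w j y‖ₑ ≤ q ^ j * q ^ j := fun j => by
    simp_rw [hw, enorm_indicator_eq_indicator_enorm]
    rw [lintegral_indicator measurableSet_ball]
    exact (hkj j).le
  have hvol : ∀ j, volume {x | q ^ j < hlMaximal (w j) x} ≤ ENNReal.ofReal (5 ^ n) * q ^ j := by
    intro j
    have h0 : q ^ j ≠ 0 := pow_ne_zero _ hq0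
    have ht : q ^ j ≠ ⊤ := ENNReal.pow_ne_top hq1.ne_top
    rw [← ENNReal.mul_le_mul_iff_right h0 ht]
    calc q ^ j * volume {x | q ^ j < hlMaximal (w j) x}
        ≤ ENNReal.ofReal (5 ^ n) * ∫⁻ y, ‖w j y‖ₑ := mul_volume_lt_hlMaximal_le _ _
      _ ≤ ENNReal.ofReal (5 ^ n) * (q ^ j * q ^ j) := by gcongr; exact hwint j
      _ = _ := by ring
  have hsum : ∑' j, volume {x | q ^ j < hlMaximal (w j) x} ≠ ⊤ := by
    refine ne_top_of_le_ne_top ?_ (ENNReal.tsum_le_tsum hvol)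
    rw [ENNReal.tsum_mul_left, ENNReal.tsum_geometric]
    refine ENNReal.mul_ne_top ENNReal.ofReal_ne_top ?_
    exact ENNReal.inv_ne_top.2 (tsub_pos_of_lt hq1).ne'
  filter_upwards [ae_eventually_notMem hsum] with x hx
  have hlim : Tendsto (fun j => max (q ^ j) (C * τ j)) atTop (𝓝 0) := by
    have h1 := ENNReal.tendsto_pow_atTop_nhds_zero_of_lt_one hq1
    have h2 : Tendsto (fun j => C * τ j) atTop (𝓝 0) := by
      simpa using ENNReal.Tendsto.const_mul hτ (Or.inr hC)
    simpa using h1.max h2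
  refine tendsto_of_tendsto_of_tendsto_of_le_of_le' tendsto_const_nhds hlim
    (Eventually.of_forall fun _ => zero_le) ?_
  obtain ⟨J, hJ⟩ := exists_nat_gt (dist x 0)
  filter_upwards [hx, eventually_ge_atTop (J + 1)] with j hj hjJ
  have hxj : x ∈ Metric.ball (0 : Rn n) j := hJ.trans (by exact_mod_cast hjJ)
  refine (hle _ (hv (k j)) j (by omega) x hxj).trans (max_le_max ?_ ?_)
  · simpa using hj
  · gcongr
    exact hvC _

/-! ### Mollification and translates of Sobolev functions -/

/-- The convolution `(f ∗ ψ)(x) = ∫ f(y) ψ(x - y) dy`. -/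
noncomputable def mollify {n : ℕ} (ψ f : Rn n → ℝ) (x : Rn n) : ℝ :=
  ∫ y, f y * ψ (x - y)

theorem mollify_eq_convolution {n : ℕ} (ψ f : Rn n → ℝ) :
    mollify ψ f = convolution f ψ (ContinuousLinearMap.mul ℝ ℝ) volume := rfl

theorem mollify_eq_convolution_lsmul {n : ℕ} (ψ f : Rn n → ℝ) (x : Rn n) :
    mollify ψ f x = convolution ψ f (ContinuousLinearMap.lsmul ℝ ℝ) volume x := by
  rw [convolution_eq_swap]
  simp [mollify, mul_comm]

theorem hasCompactSupport_sub_left {n : ℕ} {ψ : Rn n → ℝ} (hc : HasCompactSupport ψ) (x : Rn n) :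
    HasCompactSupport fun y => ψ (x - y) :=
  hc.comp_homeomorph (Homeomorph.subLeft x)

theorem contDiff_mollify {n : ℕ} {ψ f : Rn n → ℝ} (hψ : ContDiff ℝ ∞ ψ)
    (hc : HasCompactSupport ψ) (hf : LocallyIntegrable f volume) :
    ContDiff ℝ ∞ (mollify ψ f) :=
  hc.contDiff_convolution_right (n := ⊤) (ContinuousLinearMap.mul ℝ ℝ) hf hψ

/-- The gradient of a mollification is the mollification of the weak gradient. -/
theorem fderiv_mollify_apply {n : ℕ} {ψ f : Rn n → ℝ} {g : Rn n → Rn n} (hψ : ContDiff ℝ ∞ ψ)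
    (hc : HasCompactSupport ψ) (hf : LocallyIntegrable f volume) (hg : LocallyIntegrable g volume)
    (hfg : IsWeakGradient f g) (x h : Rn n) :
    fderiv ℝ (mollify ψ f) x h = ∫ y, inner ℝ h (g y) * ψ (x - y) := by
  have hψ1 : ContDiff ℝ 1 ψ := hψ.of_le (by simp)
  have hder := hc.hasFDerivAt_convolution_right (ContinuousLinearMap.mul ℝ ℝ) hf hψ1 x
  have hsingle : ∀ i, fderiv ℝ (mollify ψ f) x (EuclideanSpace.single i 1) =
      ∫ y, g y i * ψ (x - y) := by
    intro i
    rw [mollify_eq_convolution, hder.fderiv,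
      convolution_precompR_apply (ContinuousLinearMap.mul ℝ ℝ) hf (hc.fderiv ℝ)
        (hψ1.continuous_fderiv (by simp))]
    have hw := hfg (fun y => ψ (x - y)) (hψ.comp (contDiff_const.sub contDiff_id))
      (hasCompactSupport_sub_left hc x) i
    rw [← neg_eq_iff_eq_neg, ← integral_neg] at hw
    rw [← hw, convolution_def]
    refine integral_congr_ae (Eventually.of_forall fun y => ?_)
    simp only [ContinuousLinearMap.mul_apply']
    have hcs : HasFDerivAt (fun y => ψ (x - y))
        ((fderiv ℝ ψ (x - y)).comp (-ContinuousLinearMap.id ℝ (Rn n))) y :=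
      ((hψ1.differentiable (by simp)) (x - y)).hasFDerivAt.comp y
        ((hasFDerivAt_id y).const_sub x)
    rw [hcs.fderiv]
    simp
  have hsum : h = ∑ i, h i • EuclideanSpace.single i (1 : ℝ) := by
    ext j
    simp [Pi.single_apply]
  conv_lhs => rw [hsum]
  simp only [map_sum, map_smul, hsingle, smul_eq_mul]
  simp_rw [PiLp.inner_apply, Finset.sum_mul]
  rw [integral_finsetSum]
  · refine Finset.sum_congr rfl fun i _ => ?_
    rw [← integral_const_mul]
    refine integral_congr_ae (Eventually.of_forall fun y => ?_)
    simp
    ring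
  · intro i _
    have := (integrable_mul_test (locallyIntegrable_coord hg i)
      (hψ.continuous.comp (continuous_const.sub continuous_id))
      (hasCompactSupport_sub_left hc x)).const_mul (h i)
    refine this.congr (Eventually.of_forall fun y => ?_)
    simp
    ring

theorem enorm_fderiv_mollify_apply_le {n : ℕ} {ψ f : Rn n → ℝ} {g : Rn n → Rn n}
    (hψ : ContDiff ℝ ∞ ψ) (hc : HasCompactSupport ψ) (hf : LocallyIntegrable f volume)
    (hg : LocallyIntegrable g volume) (hfg : IsWeakGradient f g) (x h : Rn n) :
    ‖fderiv ℝ (mollify ψ f) x h‖ₑ ≤ ‖h‖ₑ * ∫⁻ z, ‖g (x - z)‖ₑ * ‖ψ z‖ₑ := by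
  rw [fderiv_mollify_apply hψ hc hf hg hfg, ← lintegral_const_mul' _ _ enorm_ne_top]
  refine (enorm_integral_le_lintegral_enorm _).trans ?_
  rw [← lintegral_sub_left_eq_self _ x]
  refine lintegral_mono fun z => ?_
  rw [enorm_mul, sub_sub_cancel, ← mul_assoc]
  gcongr
  rw [← ofReal_norm, ← ofReal_norm, ← ofReal_norm, ← ENNReal.ofReal_mul (norm_nonneg _)]
  exact ENNReal.ofReal_le_ofReal (norm_inner_le_norm _ _)

theorem setLIntegral_ball_comp_add_le {n : ℕ} (G : Rn n → ℝ≥0∞) (r : ℝ) {ρ : ℝ} {c : Rn n}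
    (hc : ‖c‖ ≤ ρ) :
    ∫⁻ x in Metric.ball 0 r, G (x + c) ≤ ∫⁻ x in Metric.ball 0 (r + ρ), G x := by
  rw [← lintegral_indicator measurableSet_ball, ← lintegral_indicator measurableSet_ball,
    ← lintegral_add_right_eq_self ((Metric.ball 0 (r + ρ)).indicator G) c]
  refine lintegral_mono fun x => ?_
  by_cases hx : x ∈ Metric.ball (0 : Rn n) r
  · have : x + c ∈ Metric.ball (0 : Rn n) (r + ρ) := by
      rw [mem_ball_zero_iff] at hx ⊢
      exact (norm_add_le _ _).trans_lt (by linarith)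
    simp [Set.indicator_of_mem hx, Set.indicator_of_mem this]
  · simp [Set.indicator_of_notMem hx]

/-- Young's inequality `‖G ∗ |ψ|‖₁ ≤ ‖G‖₁ ‖ψ‖₁`, localized to balls and with a translation. -/
theorem setLIntegral_ball_lintegral_sub_mul_le {n : ℕ} {G : Rn n → ℝ≥0∞} (hG : Measurable G)
    {ψ : Rn n → ℝ} (hψ : Measurable ψ) (hsupp : ∀ z, ψ z ≠ 0 → ‖z‖ ≤ 1) (r : ℝ) {a : Rn n}
    (ha : ‖a‖ ≤ 1) :
    ∫⁻ x in Metric.ball 0 r, ∫⁻ z, G (x + a - z) * ‖ψ z‖ₑ ≤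
      (∫⁻ x in Metric.ball 0 (r + 2), G x) * ∫⁻ z, ‖ψ z‖ₑ := by
  rw [lintegral_lintegral_swap (by fun_prop), ← lintegral_const_mul _ hψ.enorm]
  refine lintegral_mono fun z => ?_
  rw [lintegral_mul_const _ (by fun_prop)]
  by_cases hz : ψ z = 0
  · simp [hz]
  · refine mul_le_mul' ?_ le_rfl
    simp_rw [add_sub_assoc]
    exact setLIntegral_ball_comp_add_le G r
      ((norm_sub_le _ _).trans (by linarith [hsupp z hz]))

theorem ContDiffBump.lintegral_enorm_normed {n : ℕ} (φ : ContDiffBump (0 : Rn n)) :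
    ∫⁻ z, ‖φ.normed volume z‖ₑ = 1 := by
  have h := ofReal_integral_eq_lintegral_ofReal (φ.integrable_normed (μ := volume))
    (Eventually.of_forall φ.nonneg_normed)
  rw [φ.integral_normed, ENNReal.ofReal_one] at h
  rw [h]
  refine lintegral_congr fun z => ?_
  rw [Real.enorm_eq_ofReal (φ.nonneg_normed z)]

theorem ContDiffBump.norm_lt_of_normed_ne_zero {n : ℕ} (φ : ContDiffBump (0 : Rn n)) {z : Rn n}
    (hz : φ.normed volume z ≠ 0) : ‖z‖ < φ.rOut := by
  have : z ∈ Function.support (φ.normed volume) := hz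
  rwa [φ.support_normed_eq, mem_ball_zero_iff] at this

/-- For a mollified function the translation estimate follows from the fundamental theorem of
calculus along the segments from `x` to `x + h`; the bound does not depend on the scale. -/
theorem setLIntegral_enorm_mollify_translate_sub_le {n : ℕ} {f : Rn n → ℝ} {g : Rn n → Rn n}
    (hf : LocallyIntegrable f volume) (hg : LocallyIntegrable g volume) (hgm : Measurable g)
    (hfg : IsWeakGradient f g) (φ : ContDiffBump (0 : Rn n)) (hφ : φ.rOut ≤ 1) (r : ℝ) {h : Rn n}
    (hh : ‖h‖ ≤ 1) :
    ∫⁻ x in Metric.ball 0 r,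
        ‖mollify (φ.normed volume) f (x + h) - mollify (φ.normed volume) f x‖ₑ ≤
      ‖h‖ₑ * ∫⁻ x in Metric.ball 0 (r + 2), ‖g x‖ₑ := by
  set ψ := φ.normed volume
  have hψ : ContDiff ℝ ∞ ψ := φ.contDiff_normed (n := ⊤)
  have hc : HasCompactSupport ψ := φ.hasCompactSupport_normed
  have hw : ContDiff ℝ ∞ (mollify ψ f) := contDiff_mollify hψ hc hf
  have hw' : Continuous (fderiv ℝ (mollify ψ f)) := hw.continuous_fderiv (by simp)
  have hpt : ∀ x, ‖mollify ψ f (x + h) - mollify ψ f x‖ₑ ≤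
      ∫⁻ t in Set.Ioc (0 : ℝ) 1, ‖fderiv ℝ (mollify ψ f) (x + t • h) h‖ₑ := by
    intro x
    have hcont : Continuous fun t : ℝ => fderiv ℝ (mollify ψ f) (x + t • h) h := by fun_prop
    have hftc := intervalIntegral.integral_eq_sub_of_hasDerivAt (a := 0) (b := 1)
      (f := fun t : ℝ => mollify ψ f (x + t • h))
      (f' := fun t : ℝ => fderiv ℝ (mollify ψ f) (x + t • h) h) (fun t _ => by
        have h1 : HasDerivAt (fun t : ℝ => x + t • h) h t := by
          simpa using ((hasDerivAt_id t).smul_const h).const_add x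
        exact ((hw.differentiable (by simp)) (x + t • h)).hasFDerivAt.comp_hasDerivAt t h1)
      (hcont.intervalIntegrable _ _)
    simp only [one_smul, zero_smul, add_zero] at hftc
    rw [← hftc, intervalIntegral.integral_of_le zero_le_one]
    exact enorm_integral_le_lintegral_enorm _
  calc ∫⁻ x in Metric.ball 0 r, ‖mollify ψ f (x + h) - mollify ψ f x‖ₑ
      ≤ ∫⁻ x in Metric.ball 0 r, ∫⁻ t in Set.Ioc (0 : ℝ) 1,
          ‖fderiv ℝ (mollify ψ f) (x + t • h) h‖ₑ := lintegral_mono hpt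
    _ = ∫⁻ t in Set.Ioc (0 : ℝ) 1, ∫⁻ x in Metric.ball 0 r,
          ‖fderiv ℝ (mollify ψ f) (x + t • h) h‖ₑ := by
        refine lintegral_lintegral_swap (Continuous.aemeasurable ?_)
        fun_prop
    _ ≤ ∫⁻ _ in Set.Ioc (0 : ℝ) 1, ‖h‖ₑ * ∫⁻ x in Metric.ball 0 (r + 2), ‖g x‖ₑ := by
        refine setLIntegral_mono measurable_const fun t ht => ?_
        have hth : ‖t • h‖ ≤ 1 := by
          rw [norm_smul, Real.norm_of_nonneg ht.1.le]
          exact mul_le_one₀ ht.2 (norm_nonneg _) hh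
        calc ∫⁻ x in Metric.ball 0 r, ‖fderiv ℝ (mollify ψ f) (x + t • h) h‖ₑ
            ≤ ∫⁻ x in Metric.ball 0 r, ‖h‖ₑ * ∫⁻ z, ‖g (x + t • h - z)‖ₑ * ‖ψ z‖ₑ :=
              lintegral_mono fun x => enorm_fderiv_mollify_apply_le hψ hc hf hg hfg _ _
          _ = ‖h‖ₑ * ∫⁻ x in Metric.ball 0 r, ∫⁻ z, ‖g (x + t • h - z)‖ₑ * ‖ψ z‖ₑ :=
              lintegral_const_mul' _ _ enorm_ne_top
          _ ≤ ‖h‖ₑ * ((∫⁻ x in Metric.ball 0 (r + 2), ‖g x‖ₑ) * ∫⁻ z, ‖ψ z‖ₑ) := by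
              gcongr
              exact setLIntegral_ball_lintegral_sub_mul_le hgm.enorm hψ.continuous.measurable
                (fun z hz => (φ.norm_lt_of_normed_ne_zero hz).le.trans hφ) r hth
          _ = _ := by rw [φ.lintegral_enorm_normed, mul_one]
    _ = _ := by simp

theorem exists_contDiffBump_seq (n : ℕ) : ∃ φ : ℕ → ContDiffBump (0 : Rn n),
    (∀ m, (φ m).rOut ≤ 1) ∧ Tendsto (fun m => (φ m).rOut) atTop (𝓝 0) ∧
      ∀ m, (φ m).rOut ≤ 2 * (φ m).rIn := by
  refine ⟨fun m => ⟨1 / (2 * ((m : ℝ) + 1)), 1 / ((m : ℝ) + 1), by positivity, ?_⟩,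
    fun m => ?_, ?_, fun m => ?_⟩
  · have : (0 : ℝ) < (m : ℝ) + 1 := by positivity
    exact one_div_lt_one_div_of_lt this (by linarith)
  · exact (div_le_one (by positivity)).2 (by simp)
  · exact tendsto_one_div_add_atTop_nhds_zero_nat
  · refine le_of_eq ?_
    field_simp

/-- Translates of a Sobolev function: `‖f(· + h) - f‖_{L¹(B_r)} ≤ |h| ‖∇f‖_{L¹(B_{r+2})}`. -/
theorem setLIntegral_enorm_translate_sub_le {n : ℕ} {f : Rn n → ℝ} {g : Rn n → Rn n}
    (hf : LocallyIntegrable f volume) (hg : LocallyIntegrable g volume) (hgm : Measurable g)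
    (hfg : IsWeakGradient f g) (r : ℝ) {h : Rn n} (hh : ‖h‖ ≤ 1) :
    ∫⁻ x in Metric.ball 0 r, ‖f (x + h) - f x‖ₑ ≤
      ‖h‖ₑ * ∫⁻ x in Metric.ball 0 (r + 2), ‖g x‖ₑ := by
  -- Fatou's lemma along mollifications, which converge almost everywhere.
  obtain ⟨φ, hφ1, hφ0, hφ2⟩ := exists_contDiffBump_seq n
  have hae : ∀ᵐ x ∂(volume : Measure (Rn n)),
      Tendsto (fun m => mollify ((φ m).normed volume) f x) atTop (𝓝 (f x)) := by
    simp_rw [mollify_eq_convolution_lsmul]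
    exact ContDiffBump.ae_convolution_tendsto_right_of_locallyIntegrable hφ0
      (Eventually.of_forall hφ2) hf
  have hae' := (measurePreserving_add_right (volume : Measure (Rn n))
    h).quasiMeasurePreserving.ae hae
  have hcont : ∀ m, Continuous (mollify ((φ m).normed volume) f) := fun m =>
    (contDiff_mollify ((φ m).contDiff_normed (n := ⊤)) (φ m).hasCompactSupport_normed hf).continuous
  calc ∫⁻ x in Metric.ball 0 r, ‖f (x + h) - f x‖ₑ
      = ∫⁻ x in Metric.ball 0 r, liminf (fun m => ‖mollify ((φ m).normed volume) f (x + h) -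
          mollify ((φ m).normed volume) f x‖ₑ) atTop := by
        refine lintegral_congr_ae (ae_restrict_of_ae ?_)
        filter_upwards [hae, hae'] with x h1 h2
        exact ((h2.sub h1).enorm.liminf_eq).symm
    _ ≤ liminf (fun m => ∫⁻ x in Metric.ball 0 r, ‖mollify ((φ m).normed volume) f (x + h) -
          mollify ((φ m).normed volume) f x‖ₑ) atTop := by
        refine lintegral_liminf_le fun m => Continuous.measurable ?_
        have := hcont m
        fun_prop
    _ ≤ liminf (fun _ : ℕ => ‖h‖ₑ * ∫⁻ x in Metric.ball 0 (r + 2), ‖g x‖ₑ) atTop :=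
        liminf_le_liminf (Eventually.of_forall fun m =>
          setLIntegral_enorm_mollify_translate_sub_le hf hg hgm hfg (φ m) (hφ1 m) r hh)
    _ = _ := liminf_const _

/-- Mollification at scale `ε` moves a Sobolev function by at most `ε ‖∇f‖_{L¹(B_{r+2})}` in
`L¹(B_r)`. -/
theorem setLIntegral_enorm_mollify_sub_le {n : ℕ} {f : Rn n → ℝ} {g : Rn n → Rn n}
    (hf : LocallyIntegrable f volume) (hfm : Measurable f) (hg : LocallyIntegrable g volume)
    (hgm : Measurable g) (hfg : IsWeakGradient f g) (φ : ContDiffBump (0 : Rn n))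
    (hφ : φ.rOut ≤ 1) (r : ℝ) :
    ∫⁻ x in Metric.ball 0 r, ‖mollify (φ.normed volume) f x - f x‖ₑ ≤
      ENNReal.ofReal φ.rOut * ∫⁻ x in Metric.ball 0 (r + 2), ‖g x‖ₑ := by
  set ψ := φ.normed volume
  have hψ : Continuous ψ := φ.continuous_normed
  have hpt : ∀ x, ‖mollify ψ f x - f x‖ₑ ≤ ∫⁻ z, ‖f (x + -z) - f x‖ₑ * ‖ψ z‖ₑ := by
    intro x
    have hi : Integrable (fun z => f (x - z) * ψ z) volume := by
      have := (integrable_mul_test hf (hψ.comp (continuous_const.sub continuous_id))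
        (hasCompactSupport_sub_left φ.hasCompactSupport_normed x)).comp_sub_left x
      simpa using this
    have h1 : mollify ψ f x = ∫ z, f (x - z) * ψ z := by
      rw [mollify, ← integral_sub_left_eq_self _ volume x]
      simp
    have h2 : f x = ∫ z, f x * ψ z := by
      rw [integral_const_mul, φ.integral_normed, mul_one]
    have h3 : mollify ψ f x - f x = ∫ z, (f (x + -z) - f x) * ψ z := by
      simp_rw [sub_mul, ← sub_eq_add_neg]
      rw [integral_sub hi (φ.integrable_normed.const_mul _), ← h1, ← h2]
    rw [h3]
    simpa only [enorm_mul] using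
      enorm_integral_le_lintegral_enorm (fun z => (f (x + -z) - f x) * ψ z)
  calc ∫⁻ x in Metric.ball 0 r, ‖mollify ψ f x - f x‖ₑ
      ≤ ∫⁻ x in Metric.ball 0 r, ∫⁻ z, ‖f (x + -z) - f x‖ₑ * ‖ψ z‖ₑ := lintegral_mono hpt
    _ = ∫⁻ z, ∫⁻ x in Metric.ball 0 r, ‖f (x + -z) - f x‖ₑ * ‖ψ z‖ₑ := by
        have := hψ.measurable
        exact lintegral_lintegral_swap (by fun_prop)
    _ ≤ ∫⁻ z, ENNReal.ofReal φ.rOut * (∫⁻ x in Metric.ball 0 (r + 2), ‖g x‖ₑ) * ‖ψ z‖ₑ := by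
        refine lintegral_mono fun z => ?_
        rw [lintegral_mul_const _ (by fun_prop)]
        by_cases hz : ψ z = 0
        · simp [hz]
        · have hzφ := (φ.norm_lt_of_normed_ne_zero hz).le
          gcongr
          refine (setLIntegral_enorm_translate_sub_le hf hg hgm hfg r
            (by simpa using hzφ.trans hφ)).trans ?_
          gcongr
          rw [enorm_neg, ← ofReal_norm]
          exact ENNReal.ofReal_le_ofReal hzφ
    _ = _ := by
        rw [lintegral_const_mul _ hψ.measurable.enorm, φ.lintegral_enorm_normed, mul_one]

/-! ### Weakly convergent sequences in the Sobolev space -/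

theorem enorm_mollify_le {n : ℕ} {p : ℝ≥0∞} (hp : 1 ≤ p) {f : Rn n → ℝ}
    (hf : AEStronglyMeasurable f volume) {ψ : Rn n → ℝ} {C : ℝ} (hC : ∀ z, ‖ψ z‖ ≤ C)
    (hsupp : ∀ z, ψ z ≠ 0 → ‖z‖ < 1) (x : Rn n) :
    ‖mollify ψ f x‖ₑ ≤ eLpNorm f p volume *
      (volume (Metric.ball (0 : Rn n) 1) ^ (1 - 1 / p.toReal) * ENNReal.ofReal C) := by
  calc ‖mollify ψ f x‖ₑ
      ≤ ∫⁻ y, ‖f y * ψ (x - y)‖ₑ := enorm_integral_le_lintegral_enorm _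
    _ ≤ ∫⁻ y, (Metric.ball x 1).indicator (fun y => ‖f y‖ₑ * ENNReal.ofReal C) y := by
        refine lintegral_mono fun y => ?_
        by_cases hy : ψ (x - y) = 0
        · simp [hy]
        · have hyx : y ∈ Metric.ball x 1 := by
            rw [mem_ball_iff_norm']
            exact hsupp _ hy
          rw [Set.indicator_of_mem hyx, enorm_mul]
          gcongr
          rw [← ofReal_norm]
          exact ENNReal.ofReal_le_ofReal (hC _)
    _ = (∫⁻ y in Metric.ball x 1, ‖f y‖ₑ) * ENNReal.ofReal C := by
        rw [lintegral_indicator measurableSet_ball, lintegral_mul_const' _ _ ENNReal.ofReal_ne_top]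
    _ ≤ _ := by
        rw [← mul_assoc, ← Measure.addHaar_ball_center volume x]
        gcongr
        exact setLIntegral_enorm_le_eLpNorm hp hf _

theorem mollify_congr_ae {n : ℕ} {ψ f g : Rn n → ℝ} (h : f =ᵐ[volume] g) (x : Rn n) :
    mollify ψ f x = mollify ψ g x :=
  integral_congr_ae (by filter_upwards [h] with y hy; rw [hy])

section Sobolev

variable {n : ℕ} {p : ℝ≥0∞} [hp : Fact (1 ≤ p)]

theorem eLpNorm_sobolevFun_le (u : SobolevW1p n p) : eLpNorm (sobolevFun u) p volume ≤ ‖u‖ₑ := by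
  have h : ‖u.1.fst‖ ≤ ‖u.1‖ := by
    rw [WithLp.prod_norm_eq_of_L1]
    exact le_add_of_nonneg_right (norm_nonneg _)
  rw [sobolevFun, ← Lp.enorm_def, ← ofReal_norm, ← ofReal_norm]
  exact ENNReal.ofReal_le_ofReal h

theorem eLpNorm_gradient_le (u : SobolevW1p n p) :
    eLpNorm (u.1.snd : Rn n → Rn n) p volume ≤ ‖u‖ₑ := by
  have h : ‖u.1.snd‖ ≤ ‖u.1‖ := by
    rw [WithLp.prod_norm_eq_of_L1]
    exact le_add_of_nonneg_left (norm_nonneg _)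
  rw [← Lp.enorm_def, ← ofReal_norm, ← ofReal_norm]
  exact ENNReal.ofReal_le_ofReal h

theorem locallyIntegrable_sobolevFun (u : SobolevW1p n p) :
    LocallyIntegrable (sobolevFun u) volume :=
  (Lp.memLp u.1.fst).locallyIntegrable hp.out

theorem stronglyMeasurable_sobolevFun (u : SobolevW1p n p) : StronglyMeasurable (sobolevFun u) :=
  Lp.stronglyMeasurable u.1.fst

theorem sobolevFun_add (u v : SobolevW1p n p) :
    sobolevFun (u + v) =ᵐ[volume] sobolevFun u + sobolevFun v :=
  Lp.coeFn_add u.1.fst v.1.fst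

theorem sobolevFun_smul (c : ℝ) (u : SobolevW1p n p) :
    sobolevFun (c • u) =ᵐ[volume] c • sobolevFun u :=
  Lp.coeFn_smul c u.1.fst

/-- Evaluation of a mollification at a point, as a linear functional on the Sobolev space. -/
noncomputable def mollifyEvalLinear {ψ : Rn n → ℝ} (hψ : Continuous ψ) (hc : HasCompactSupport ψ)
    (x : Rn n) : SobolevW1p n p →ₗ[ℝ] ℝ where
  toFun u := mollify ψ (sobolevFun u) x
  map_add' u v := by
    rw [mollify_congr_ae (sobolevFun_add u v)]
    simp only [mollify, Pi.add_apply, add_mul]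
    have hψx := hψ.comp (continuous_const (y := x) |>.sub continuous_id)
    exact integral_add
      (integrable_mul_test (locallyIntegrable_sobolevFun u) hψx (hasCompactSupport_sub_left hc x))
      (integrable_mul_test (locallyIntegrable_sobolevFun v) hψx (hasCompactSupport_sub_left hc x))
  map_smul' c u := by
    rw [mollify_congr_ae (sobolevFun_smul c u)]
    simp [mollify, mul_assoc, integral_const_mul]

theorem one_sub_one_div_toReal_nonneg {p : ℝ≥0∞} (hp : 1 ≤ p) : 0 ≤ 1 - 1 / p.toReal := by
  rcases eq_or_ne p ⊤ with hpt | hpt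
  · simp [hpt]
  · have : 1 ≤ p.toReal := by
      simpa using ENNReal.toReal_mono hpt hp
    rw [sub_nonneg]
    exact (div_le_one (by linarith)).2 this

/-- Evaluation of a mollification at a point is continuous on the Sobolev space. -/
theorem exists_norm_mollifyEvalLinear_le {ψ : Rn n → ℝ} (hψ : Continuous ψ)
    (hc : HasCompactSupport ψ) {C : ℝ} (hC : ∀ z, ‖ψ z‖ ≤ C) (hsupp : ∀ z, ψ z ≠ 0 → ‖z‖ < 1)
    (x : Rn n) : ∃ K : ℝ, ∀ u : SobolevW1p n p, ‖mollifyEvalLinear hψ hc x u‖ ≤ K * ‖u‖ := by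
  set K : ℝ≥0∞ := volume (Metric.ball (0 : Rn n) 1) ^ (1 - 1 / p.toReal) * ENNReal.ofReal C
    with hKdef
  have hK : K ≠ ⊤ := ENNReal.mul_ne_top (ENNReal.rpow_ne_top_of_nonneg
    (one_sub_one_div_toReal_nonneg hp.out) measure_ball_lt_top.ne) ENNReal.ofReal_ne_top
  refine ⟨K.toReal, fun u => ?_⟩
  have h : ‖mollify ψ (sobolevFun u) x‖ₑ ≤ ‖u‖ₑ * K := by
    refine (enorm_mollify_le hp.out (stronglyMeasurable_sobolevFun u).aestronglyMeasurable
      hC hsupp x).trans ?_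
    gcongr
    exact eLpNorm_sobolevFun_le u
  have h2 := ENNReal.toReal_mono (ENNReal.mul_ne_top enorm_ne_top hK) h
  rw [ENNReal.toReal_mul, toReal_enorm, toReal_enorm, mul_comm] at h2
  exact h2

/-- A weakly convergent sequence is bounded, by the uniform boundedness principle on the dual. -/
theorem exists_norm_le_of_tendsto_weak {E : Type*} [NormedAddCommGroup E] [NormedSpace ℝ E]
    {v : ℕ → E} {l : E} (h : ∀ L : E →L[ℝ] ℝ, Tendsto (fun k => L (v k)) atTop (𝓝 (L l))) :
    ∃ C, ∀ k, ‖v k‖ ≤ C := by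
  obtain ⟨C, hC⟩ := banach_steinhaus
    (g := fun k => NormedSpace.inclusionInDoubleDualLi ℝ (v k)) fun L => by
      obtain ⟨C, hC⟩ := (h L).norm.bddAbove_range
      exact ⟨C, fun k => hC ⟨k, rfl⟩⟩
  exact ⟨C, fun k => by
    simpa only [LinearIsometry.norm_map] using hC k⟩

/-- The compactness theorem of Rellich and Kondrachov in the form needed here: weak convergence to
zero in `W^{1,p}` implies convergence to zero in `L¹` of every ball. -/
theorem tendsto_setLIntegral_sobolevFun_of_weak {v : ℕ → SobolevW1p n p}
    (h : ∀ L : SobolevW1p n p →L[ℝ] ℝ, Tendsto (fun k => L (v k)) atTop (𝓝 0)) (r : ℝ) :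
    Tendsto (fun k => ∫⁻ y in Metric.ball 0 r, ‖sobolevFun (v k) y‖ₑ) atTop (𝓝 0) := by
  obtain ⟨C, hC⟩ := exists_norm_le_of_tendsto_weak (v := v) (l := 0) (fun L => by simpa using h L)
  have hCe : ∀ k, ‖v k‖ₑ ≤ ENNReal.ofReal C := fun k => by
    rw [← ofReal_norm]
    exact ENNReal.ofReal_le_ofReal (hC k)
  set G : ℝ≥0∞ :=
    ENNReal.ofReal C * volume (Metric.ball (0 : Rn n) (r + 2)) ^ (1 - 1 / p.toReal) with hG
  have hexp := one_sub_one_div_toReal_nonneg hp.out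
  have hGt : G ≠ ⊤ := ENNReal.mul_ne_top ENNReal.ofReal_ne_top
    (ENNReal.rpow_ne_top_of_nonneg hexp measure_ball_lt_top.ne)
  have hgrad : ∀ k, ∫⁻ x in Metric.ball 0 (r + 2), ‖((v k).1.snd : Rn n → Rn n) x‖ₑ ≤ G := by
    intro k
    refine (setLIntegral_enorm_le_eLpNorm hp.out (Lp.aestronglyMeasurable (v k).1.snd) _).trans ?_
    rw [hG]
    gcongr
    exact (eLpNorm_gradient_le (v k)).trans (hCe k)
  obtain ⟨φ, hφ1, hφ0, -⟩ := exists_contDiffBump_seq n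
  -- At each fixed scale the mollified sequence tends to zero pointwise and boundedly.
  have hmoll : ∀ m, Tendsto (fun k => ∫⁻ x in Metric.ball 0 r,
      ‖mollify ((φ m).normed volume) (sobolevFun (v k)) x‖ₑ) atTop (𝓝 0) := by
    intro m
    obtain ⟨K, hK⟩ := (φ m).hasCompactSupport_normed (μ := volume).exists_bound_of_continuous
      (φ m).continuous_normed
    have hsupp : ∀ z, (φ m).normed volume z ≠ 0 → ‖z‖ < 1 := fun z hz =>
      ((φ m).norm_lt_of_normed_ne_zero hz).trans_le (hφ1 m)
    have hlim := tendsto_lintegral_of_dominated_convergence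
      (μ := volume.restrict (Metric.ball (0 : Rn n) r))
      (F := fun k x => ‖mollify ((φ m).normed volume) (sobolevFun (v k)) x‖ₑ) (f := fun _ => 0)
      (fun _ => ENNReal.ofReal C *
        (volume (Metric.ball (0 : Rn n) 1) ^ (1 - 1 / p.toReal) * ENNReal.ofReal K))
      (fun k => (contDiff_mollify ((φ m).contDiff_normed (n := ⊤)) (φ m).hasCompactSupport_normed
        (locallyIntegrable_sobolevFun (v k))).continuous.measurable.enorm)
      (fun k => Eventually.of_forall fun x => (enorm_mollify_le hp.out
        (stronglyMeasurable_sobolevFun (v k)).aestronglyMeasurable hK hsupp x).trans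
          (mul_le_mul' ((eLpNorm_sobolevFun_le (v k)).trans (hCe k)) le_rfl))
      (by
        rw [setLIntegral_const]
        exact ENNReal.mul_ne_top (ENNReal.mul_ne_top ENNReal.ofReal_ne_top
          (ENNReal.mul_ne_top (ENNReal.rpow_ne_top_of_nonneg hexp measure_ball_lt_top.ne)
            ENNReal.ofReal_ne_top)) measure_ball_lt_top.ne)
      (Eventually.of_forall fun x => by
        obtain ⟨M, hM⟩ := exists_norm_mollifyEvalLinear_le (p := p) (φ m).continuous_normed
          (φ m).hasCompactSupport_normed hK hsupp x
        have := (h (LinearMap.mkContinuous _ M hM)).enorm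
        rw [enorm_zero] at this
        exact this)
    simpa using hlim
  have hbound : ∀ m k, ∫⁻ x in Metric.ball 0 r, ‖sobolevFun (v k) x‖ₑ ≤
      ENNReal.ofReal (φ m).rOut * G +
        ∫⁻ x in Metric.ball 0 r, ‖mollify ((φ m).normed volume) (sobolevFun (v k)) x‖ₑ := by
    intro m k
    have hcm : Measurable (mollify ((φ m).normed volume) (sobolevFun (v k))) :=
      (contDiff_mollify ((φ m).contDiff_normed (n := ⊤)) (φ m).hasCompactSupport_normed
        (locallyIntegrable_sobolevFun (v k))).continuous.measurable
    calc ∫⁻ x in Metric.ball 0 r, ‖sobolevFun (v k) x‖ₑ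
        ≤ ∫⁻ x in Metric.ball 0 r,
          (‖mollify ((φ m).normed volume) (sobolevFun (v k)) x - sobolevFun (v k) x‖ₑ +
            ‖mollify ((φ m).normed volume) (sobolevFun (v k)) x‖ₑ) := by
          refine lintegral_mono fun x => ?_
          rw [← enorm_neg (mollify _ _ x - _)]
          refine le_trans (le_of_eq ?_) (enorm_add_le _ _)
          congr 1
          ring
      _ = (∫⁻ x in Metric.ball 0 r,
          ‖mollify ((φ m).normed volume) (sobolevFun (v k)) x - sobolevFun (v k) x‖ₑ) +
            ∫⁻ x in Metric.ball 0 r, ‖mollify ((φ m).normed volume) (sobolevFun (v k)) x‖ₑ :=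
          lintegral_add_right _ hcm.enorm
      _ ≤ _ := by
          gcongr
          refine (setLIntegral_enorm_mollify_sub_le (locallyIntegrable_sobolevFun (v k))
            (stronglyMeasurable_sobolevFun (v k)).measurable
            ((Lp.memLp (v k).1.snd).locallyIntegrable hp.out)
            (Lp.stronglyMeasurable (v k).1.snd).measurable (v k).2 (φ m) (hφ1 m) r).trans ?_
          gcongr
          exact hgrad k
  rw [ENNReal.tendsto_nhds_zero]
  intro ε hε
  have hε2 : 0 < ε / 2 := ENNReal.half_pos hε.ne'
  have hsmall : Tendsto (fun m => ENNReal.ofReal (φ m).rOut * G) atTop (𝓝 0) := by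
    have := ENNReal.Tendsto.mul_const (ENNReal.tendsto_ofReal hφ0) (Or.inr hGt)
    simpa using this
  obtain ⟨m, hm⟩ := ((ENNReal.tendsto_nhds_zero.1 hsmall) _ hε2).exists
  filter_upwards [(ENNReal.tendsto_nhds_zero.1 (hmoll m)) _ hε2] with k hk
  exact (hbound m k).trans ((add_le_add hm hk).trans_eq (ENNReal.add_halves ε))

end Sobolev

/-! ### Convergence of maximal functions -/

theorem theorem9 (n : ℕ) (p : ℝ≥0∞) [Fact (1 ≤ p)] (hp : 1 < p) (hp' : p < ⊤)
    (u : ℕ → SobolevW1p n p) (u₀ : SobolevW1p n p)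
    (hu : Tendsto (fun k => toWeakSpace ℝ (SobolevW1p n p) (u k)) atTop
      (𝓝 (toWeakSpace ℝ (SobolevW1p n p) u₀))) :
    ∃ k : ℕ → ℕ, StrictMono k ∧
      ∀ᵐ x ∂(volume : Measure (Rn n)), hlMaximal (sobolevFun u₀) x < ⊤ ∧
        Tendsto (fun j => hlMaximal (sobolevFun (u (k j))) x) atTop (𝓝 (hlMaximal (sobolevFun u₀) x)) := by
  obtain ⟨v, hvdef⟩ : ∃ v : ℕ → SobolevW1p n p, ∀ k, v k = u k - u₀ := ⟨_, fun _ => rfl⟩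
  have hv : ∀ L : SobolevW1p n p →L[ℝ] ℝ, Tendsto (fun k => L (v k)) atTop (𝓝 0) := by
    intro L
    have hL : Tendsto (fun k => L (u k)) atTop (𝓝 (L u₀)) :=
      ((WeakBilin.eval_continuous _ L).tendsto _).comp hu
    simpa [hvdef] using hL.sub_const (L u₀)
  obtain ⟨C, hC⟩ := exists_norm_le_of_tendsto_weak (v := v) (l := 0) (fun L => by simpa using hv L)
  obtain ⟨k, hk, hlim⟩ := exists_subseq_hlMaximal_tendsto_zero hp.le hp'
    (fun k => (stronglyMeasurable_sobolevFun (v k)).aestronglyMeasurable)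
    (C := ENNReal.ofReal C) ENNReal.ofReal_ne_top
    (fun k => (eLpNorm_sobolevFun_le (v k)).trans (by
      rw [← ofReal_norm]
      exact ENNReal.ofReal_le_ofReal (hC k)))
    (tendsto_setLIntegral_sobolevFun_of_weak hv)
  refine ⟨k, hk, ?_⟩
  have hfinite : ∀ᵐ x ∂(volume : Measure (Rn n)), hlMaximal (sobolevFun u₀) x < ⊤ :=
    ae_hlMaximal_lt_top_of_memLp hp.le hp' (Lp.memLp u₀.1.fst)
  filter_upwards [hlim, hfinite] with x hx hfin
  refine ⟨hfin, ?_⟩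
  have hadd : ∀ j, sobolevFun (u (k j)) =ᵐ[volume] sobolevFun u₀ + sobolevFun (v (k j)) := by
    intro j
    have := sobolevFun_add u₀ (v (k j))
    rwa [show u₀ + v (k j) = u (k j) by rw [hvdef, add_sub_cancel]] at this
  have hupper : ∀ j, hlMaximal (sobolevFun (u (k j))) x ≤
      hlMaximal (sobolevFun u₀) x + hlMaximal (sobolevFun (v (k j))) x := fun j => by
    rw [hlMaximal_congr_ae (hadd j)]
    exact hlMaximal_add_le (stronglyMeasurable_sobolevFun u₀).measurable.aemeasurable _ x
  have hlower : ∀ j, hlMaximal (sobolevFun u₀) x - hlMaximal (sobolevFun (v (k j))) x ≤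
      hlMaximal (sobolevFun (u (k j))) x := fun j => by
    have h0 : sobolevFun u₀ =ᵐ[volume] sobolevFun (u (k j)) + -sobolevFun (v (k j)) := by
      filter_upwards [hadd j] with y hy
      simp [hy]
    rw [tsub_le_iff_right, hlMaximal_congr_ae h0, ← hlMaximal_neg (sobolevFun (v (k j)))]
    exact hlMaximal_add_le (stronglyMeasurable_sobolevFun _).measurable.aemeasurable _ x
  refine tendsto_of_tendsto_of_tendsto_of_le_of_le ?_ ?_ hlower hupper
  · simpa using ENNReal.Tendsto.sub tendsto_const_nhds hx (Or.inl hfin.ne)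
  · simpa using tendsto_const_nhds.add hx
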